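/- Let $G$ be a compact Lie group acting smoothly, effectively and transitively on a compact connected $C^\infty$-manifold $M$, let $dx$ be a nonzero finite $G$-invariant Borel measure on $M$, let $1\le p\le\infty$, and let $L_p(M)=L_p(M,dx)$ (real- or complex-valued functions). For $X$ in the Lie algebra of $G$ let $D_X$ be the generator in $L_p(M)$ of the one-parameter group of translations $(e^{tD_X}f)(x)=f(\exp(tX)\cdot x)$; that is, $f$ belongs to the domain of $D_X$ if and only if $t^{-1}(e^{tD_X}f-f)$ converges in the norm of $L_p(M)$ as $t\to 0$, and $D_Xf$ is the limit. Let $X_1,\dots,X_d$ be any finite family of elements of the Lie algebra of $G$ (in particular, one may take $d=\dim G$ and $X_1,\dots,X_d$ such that the operator $X_1^2+\dots+X_d^2$ on $C^\infty(M)$ commutes with every $X_j$), put $D_j=D_{X_j}$ and $\mathbb D=\{D_1,\dots,D_d\}$. For $\omega>0$ let $\mathbf B^p_\omega(\mathbb D)$ be the set of all $f\in L_p(M)$ such that, for all $k\in\mathbb N$ and all $1\le i_1,\dots,i_k\le d$, $f$ lies in the domain of $D_{i_1}\cdots D_{i_k}$ and $$\|D_{i_1}\cdots D_{i_k}f\|_p\le\omega^k\|f\|_p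 .$$ Then: 1. $\mathbf B^p_\omega(\mathbb D)$ is invariant under every $D_\nu$, $1\le\nu\le d$: every $f\in\mathbf B^p_\omega(\mathbb D)$ lies in the domain of $D_\nu$ and $D_\nu f\in\mathbf B^p_\omega(\mathbb D)$; 2. $\mathbf B^p_\omega(\mathbb D)$ is a linear subspace of $L_p(M)$; 3. $\mathbf B^p_\omega(\mathbb D)$ is closed in $L_p(M)$. -/

import Mathlib

open Filter Topology MeasureTheory
open scoped ENNReal Manifold ContDiff

noncomputable section

section Generator

variable {𝕜 E : Type*} [RCLike 𝕜] [NormedAddCommGroup E] [NormedSpace 𝕜 E]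

/-- The orbit `t ↦ T t f` has derivative `g` at time `0`, where `T 0` is the identity:
`(T t f - f) / t → g` in norm as `t → 0`, `t ≠ 0`. -/
def HasGeneratorAt (𝕜 : Type*) {E : Type*} [RCLike 𝕜] [NormedAddCommGroup E] [NormedSpace 𝕜 E]
    (T : ℝ → E →ₗ[𝕜] E) (f g : E) : Prop :=
  Tendsto (fun t : ℝ => ((t⁻¹ : ℝ) : 𝕜) • (T t f - f)) (𝓝[≠] 0) (𝓝 g)

theorem HasGeneratorAt.add {T : ℝ → E →ₗ[𝕜] E} {f₁ g₁ f₂ g₂ : E}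
    (h₁ : HasGeneratorAt 𝕜 T f₁ g₁) (h₂ : HasGeneratorAt 𝕜 T f₂ g₂) :
    HasGeneratorAt 𝕜 T (f₁ + f₂) (g₁ + g₂) := by
  refine (Tendsto.add h₁ h₂).congr fun t => ?_
  rw [← smul_add, map_add, add_sub_add_comm]

theorem HasGeneratorAt.smul {T : ℝ → E →ₗ[𝕜] E} {f g : E} (c : 𝕜)
    (h : HasGeneratorAt 𝕜 T f g) : HasGeneratorAt 𝕜 T (c • f) (c • g) := by
  refine (Tendsto.const_smul h c).congr fun t => ?_
  rw [map_smul, ← smul_sub, smul_comm]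

/-- The (infinitesimal) generator of a one-parameter family of operators `T t`: its domain is
the set of all `f` for which `(T t f - f) / t` has a norm limit as `t → 0`, and it sends `f` to
this limit. -/
def generator (T : ℝ → E →ₗ[𝕜] E) : E →ₗ.[𝕜] E where
  domain :=
    { carrier := {f | ∃ g, HasGeneratorAt 𝕜 T f g}
      add_mem' := fun ⟨_, h₁⟩ ⟨_, h₂⟩ => ⟨_, h₁.add h₂⟩
      zero_mem' := ⟨0, by simp [HasGeneratorAt]⟩
      smul_mem' := fun c _ ⟨_, h⟩ => ⟨_, h.smul c⟩ }
  toFun :=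
    { toFun := fun f => Classical.choose f.2
      map_add' := fun f₁ f₂ => tendsto_nhds_unique (Classical.choose_spec (f₁ + f₂).2)
        ((Classical.choose_spec f₁.2).add (Classical.choose_spec f₂.2))
      map_smul' := fun c f => tendsto_nhds_unique (Classical.choose_spec (c • f).2)
        ((Classical.choose_spec f.2).smul c) }

theorem generator_spec (T : ℝ → E →ₗ[𝕜] E) (f : (generator T).domain) :
    HasGeneratorAt 𝕜 T (f : E) (generator T f) :=
  Classical.choose_spec f.2

end Generator

section Bernstein

variable {𝕜 E ι : Type*} [RCLike 𝕜] [NormedAddCommGroup E] [NormedSpace 𝕜 E]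

/-- For a word `[i₁, …, i_k]`, the statement that `f` belongs to the domain of the composition
`D_{i₁} ⋯ D_{i_k}` of (unbounded) operators and that `D_{i₁} ⋯ D_{i_k} f = g`. -/
def IsIteratedValue (D : ι → E →ₗ.[𝕜] E) : List ι → E → E → Prop
  | [], f, g => g = f
  | i :: w, f, g => ∃ h : (D i).domain, IsIteratedValue D w f h ∧ D i h = g

/-- The Bernstein set of the operators `D i`: all `f` that lie in the domain of every composition
`D_{i₁} ⋯ D_{i_k}` and satisfy `‖D_{i₁} ⋯ D_{i_k} f‖ ≤ σ ^ k * ‖f‖`. -/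
def bernsteinSet (D : ι → E →ₗ.[𝕜] E) (σ : ℝ) : Set E :=
  {f | ∀ w : List ι, ∃ g : E, IsIteratedValue D w f g ∧ ‖g‖ ≤ σ ^ w.length * ‖f‖}

end Bernstein

section LieGroup

variable {n : ℕ} {G : Type*} [TopologicalSpace G] [ChartedSpace (EuclideanSpace ℝ (Fin n)) G]
  [Group G]

/-- `γ : ℝ → G` is a smooth one-parameter subgroup with initial velocity `X ∈ T₁G`. -/
structure IsOneParameterSubgroup (X : GroupLieAlgebra (𝓡 n) G) (γ : ℝ → G) : Prop where
  map_zero : γ 0 = 1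
  map_add : ∀ s t : ℝ, γ (s + t) = γ s * γ t
  contMDiff : ContMDiff 𝓘(ℝ, ℝ) (𝓡 n) ∞ γ
  velocity : mfderiv 𝓘(ℝ, ℝ) (𝓡 n) γ 0 (1 : ℝ) = X

open Classical in
/-- `expCurve X t` is `exp (t X)`, the value at `t` of the one-parameter subgroup of `G` with
initial velocity `X`. In a Lie group this subgroup exists and is unique, so the default value
`1` is never used there. -/
def expCurve (X : GroupLieAlgebra (𝓡 n) G) (t : ℝ) : G :=
  if h : ∃ γ : ℝ → G, IsOneParameterSubgroup X γ then Classical.choose h t else 1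

variable (𝕜 : Type*) [RCLike 𝕜] {M : Type*} [MeasurableSpace M] [MulAction G M]
  [MeasurableConstSMul G M] (μ : Measure M) [SMulInvariantMeasure G M μ]
  (p : ℝ≥0∞) [Fact (1 ≤ p)]

/-- Translation on `L_p(M)`: `(e^{tD_X} f)(x) = f (exp (t X) • x)`. -/
def flowOperator (X : GroupLieAlgebra (𝓡 n) G) (t : ℝ) : Lp 𝕜 p μ →ₗ[𝕜] Lp 𝕜 p μ :=
  Lp.compMeasurePreservingₗ 𝕜 (fun x : M => expCurve X t • x)
    (measurePreserving_smul (expCurve X t) μ)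

/-- The operator `D_X` in `L_p(M)`: the generator of `f ↦ f (exp (t X) • ·)`. -/
def fieldOperator (X : GroupLieAlgebra (𝓡 n) G) : Lp 𝕜 p μ →ₗ.[𝕜] Lp 𝕜 p μ :=
  generator (flowOperator 𝕜 μ p X)

end LieGroup

end

/-!
# Bernstein subspaces of generators of isometry groups

The operators `D_X` generate one-parameter groups of isometries `T t` of `L_p(M)`, as the measure is
invariant. Everything rests on a sharp Bernstein inequality for such a generator `D`
(`IsIsometryGroup.norm_le_of_hasGeneratorAt`): if `‖D ^ k f‖ ≤ C * σ ^ k` for all `k`, with any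
constant `C`, then `‖D f‖ ≤ σ * ‖f‖`. Consequently (`mem_bernsteinSet_iff`) the nonlinear condition
`‖D_w f‖ ≤ σ ^ |w| * ‖f‖` for all words `w` may be replaced by `‖D_w f‖ ≤ C * σ ^ |w|`, since a word is
built up letter by letter and `D_w f` satisfies a condition of the same kind. In this form linearity
and invariance under the generators are clear. For closedness, linearity gives
`‖D_w (f - f')‖ ≤ σ ^ |w| * ‖f - f'‖` on the Bernstein set, so `D_w` maps convergent sequences of the set
to convergent ones, and generators of isometry groups are closed operators
(`IsIsometryGroup.hasGeneratorAt_of_tendsto`).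

The inequality for generators follows from the one for bounded scalar functions
(`norm_deriv_zero_le_of_bounded`), applied to `t ↦ φ (T t f)` for a functional `φ` that norms `D f`.
The scalar inequality is proved by Fourier analysis. For integrable functions, bounds on the
derivatives confine the spectrum to `[-σ, σ]`, where the triangle wave, an absolutely convergent sine
series with coefficient sum `σ`, coincides with the identity; Fourier inversion turns this into
M. Riesz's interpolation formula for the derivative. A bounded function is made integrable by
multiplying it by a dilated band-limited cutoff.
-/

/-! ### The triangle wave -/

/-- The cosine series of a triangle wave: the terms of odd frequency in the Fourier series of the
Bernoulli polynomial `B₂`, obtained by removing from the series at `x` its even part, which is a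
quarter of the series at `2 * x`. -/
theorem hasSum_odd_cos_div_sq {x : ℝ} (h0 : 0 ≤ x) (h1 : x ≤ 1 / 2) :
    HasSum (fun n : ℕ => 1 / (2 * n + 1 : ℝ) ^ 2 * Real.cos (2 * Real.pi * (2 * n + 1) * x))
      (Real.pi ^ 2 / 8 * (1 - 4 * x)) := by
  have key : ∀ y ∈ Set.Icc (0 : ℝ) 1,
      HasSum (fun n : ℕ => 1 / (n : ℝ) ^ 2 * Real.cos (2 * Real.pi * n * y))
        (Real.pi ^ 2 * (y ^ 2 - y + 1 / 6)) := by
    intro y hy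
    have := hasSum_one_div_nat_pow_mul_cos one_ne_zero hy
    have hB : (Polynomial.map (algebraMap ℚ ℝ) (Polynomial.bernoulli 2)).eval y
        = y ^ 2 - y + 1 / 6 := by
      have h2 : bernoulli 2 = 1 / 6 := by
        rw [bernoulli_eq_bernoulli'_of_ne_one (by decide), bernoulli'_two]
      simp [Polynomial.bernoulli, Finset.sum_range_succ, bernoulli_one, h2,
        Polynomial.eval_monomial]
      ring
    rw [mul_one, hB] at this
    convert! this using 1
    rw [Nat.factorial_two]
    push_cast
    ring
  obtain ⟨f, hf⟩ : ∃ f : ℕ → ℝ, ∀ n : ℕ, f n = 1 / (n : ℝ) ^ 2 * Real.cos (2 * Real.pi * n * x) :=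
    ⟨_, fun _ => rfl⟩
  have hall : HasSum f (Real.pi ^ 2 * (x ^ 2 - x + 1 / 6)) :=
    (key x ⟨h0, by linarith⟩).congr_fun hf
  have heven : HasSum (fun n => f (2 * n))
      (1 / 4 * (Real.pi ^ 2 * ((2 * x) ^ 2 - 2 * x + 1 / 6))) := by
    refine ((key (2 * x) ⟨by linarith, by linarith⟩).mul_left (1 / 4)).congr_fun fun n => ?_
    rw [hf]
    push_cast
    rw [show 2 * Real.pi * (2 * n) * x = 2 * Real.pi * n * (2 * x) by ring]
    ring
  have hodd : HasSum (fun n => f (2 * n + 1)) (∑' n, f (2 * n + 1)) :=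
    (hall.summable.comp_injective
      (i := fun n : ℕ => 2 * n + 1) (fun a b h => by simpa using h)).hasSum
  have huniq := (heven.even_add_odd hodd).unique hall
  rw [show ∑' n, f (2 * n + 1) = Real.pi ^ 2 / 8 * (1 - 4 * x) by linear_combination huniq] at hodd
  refine hodd.congr_fun fun n => ?_
  rw [hf]
  push_cast
  rfl

theorem hasSum_one_div_odd_sq :
    HasSum (fun n : ℕ => 1 / (2 * n + 1 : ℝ) ^ 2) (Real.pi ^ 2 / 8) := by
  simpa using hasSum_odd_cos_div_sq (x := 0) le_rfl (by norm_num)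

/-- The sine series of the triangle wave of slope `1` on `[-σ, σ]`. Its coefficients have absolute sum
exactly `σ`, which is where the sharp constant in Bernstein's inequality comes from. -/
theorem hasSum_triangleWave {σ x : ℝ} (hσ : 0 < σ) (hx : |x| ≤ σ) :
    HasSum (fun n : ℕ => σ * (8 / Real.pi ^ 2) * ((-1) ^ n / (2 * n + 1 : ℝ) ^ 2) *
      Real.sin (x * ((2 * n + 1) * Real.pi / (2 * σ)))) x := by
  obtain ⟨h1, h2⟩ := abs_le.1 hx
  have h1' : -1 ≤ x / σ := by rw [le_div_iff₀ hσ]; linarith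
  have h2' : x / σ ≤ 1 := by rw [div_le_iff₀ hσ]; linarith
  have h := (hasSum_odd_cos_div_sq (x := (1 - x / σ) / 4) (by linarith)
    (by linarith)).mul_left (σ * (8 / Real.pi ^ 2))
  have hpi := Real.pi_ne_zero
  convert! h using 1
  · ext n
    rw [show 2 * Real.pi * (2 * n + 1) * ((1 - x / σ) / 4)
      = (Real.pi / 2 - x * ((2 * n + 1) * Real.pi / (2 * σ))) + n * Real.pi by
        field_simp; ring, Real.cos_add_nat_mul_pi, Real.cos_pi_div_two_sub]
    ring
  · field_simp
    ring

/-! ### Bernstein's inequality for scalar functions -/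

section Fourier

open scoped FourierTransform

/-- A Paley–Wiener statement: if the derivatives of `k` grow in `L¹` like `σ ^ n`, then the spectrum
of `k`, in the angular frequency `2πξ`, lies in `[-σ, σ]`. -/
theorem fourier_eq_zero_of_integral_norm_iteratedDeriv_le {k : ℝ → ℂ} {σ C : ℝ} (hσ : 0 < σ)
    (hk : ContDiff ℝ ∞ k) (hint : ∀ n : ℕ, Integrable (iteratedDeriv n k))
    (hC : ∀ n : ℕ, ∫ t, ‖iteratedDeriv n k t‖ ≤ C * σ ^ n) {ξ : ℝ}
    (hξ : σ < |2 * Real.pi * ξ|) : 𝓕 k ξ = 0 := by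
  set a := |2 * Real.pi * ξ|
  have ha : 0 < a := hσ.trans hξ
  have key : ∀ n : ℕ, ‖𝓕 k ξ‖ ≤ C * (σ / a) ^ n := by
    intro n
    have h1 : 𝓕 (iteratedDeriv n k) ξ = (2 * Real.pi * Complex.I * ξ) ^ n • 𝓕 k ξ := by
      rw [Real.fourier_iteratedDeriv (N := ⊤) (by simpa using hk) (fun n _ => hint n) le_top]
    have h2 : ‖𝓕 (iteratedDeriv n k) ξ‖ ≤ C * σ ^ n :=
      (VectorFourier.norm_fourierIntegral_le_integral_norm _ _ _ _ _).trans (hC n)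
    rw [h1, norm_smul, norm_pow, show ‖(2 * Real.pi * Complex.I * ξ : ℂ)‖ = a by simp [a]] at h2
    rw [div_pow, mul_div_assoc', le_div_iff₀ (by positivity)]
    linarith
  have hlim : Tendsto (fun n : ℕ => C * (σ / a) ^ n) atTop (𝓝 (C * 0)) :=
    (tendsto_pow_atTop_nhds_zero_of_lt_one (by positivity) ((div_lt_one ha).2 hξ)).const_mul C
  have := ge_of_tendsto' hlim key
  rw [mul_zero] at this
  exact norm_le_zero_iff.1 this

/-- Bernstein's inequality for integrable functions. On the spectrum of `k` the multiplier `2πiξ` of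
`d/dt` agrees with the triangle wave, so `k' 0 = ∑ c n * (k (a n) - k (-a n)) / 2` with
`∑ |c n| = σ` (M. Riesz's interpolation formula). -/
theorem norm_deriv_zero_le_of_integral_norm_iteratedDeriv_le {k : ℝ → ℂ} {σ C B : ℝ}
    (hσ : 0 < σ) (hk : ContDiff ℝ ∞ k) (hint : ∀ n : ℕ, Integrable (iteratedDeriv n k))
    (hC : ∀ n : ℕ, ∫ t, ‖iteratedDeriv n k t‖ ≤ C * σ ^ n) (hB : ∀ t, ‖k t‖ ≤ B) :
    ‖deriv k 0‖ ≤ σ * B := by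
  have hk0 : Integrable k := by simpa using hint 0
  have hk1 : Integrable (deriv k) := by simpa using hint 1
  have hsupp : ∀ ξ, σ < |2 * Real.pi * ξ| → 𝓕 k ξ = 0 := fun ξ =>
    fourier_eq_zero_of_integral_norm_iteratedDeriv_le hσ hk hint hC
  have hcont : Continuous (𝓕 k) :=
    VectorFourier.fourierIntegral_continuous Real.continuous_fourierChar (by fun_prop) hk0
  have hcs : HasCompactSupport (𝓕 k) := by
    refine HasCompactSupport.of_support_subset_isCompact
      (isCompact_Icc (a := -(σ / (2 * Real.pi))) (b := σ / (2 * Real.pi))) fun ξ hξ => ?_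
    by_contra hn
    refine hξ (hsupp ξ ?_)
    rw [Set.mem_Icc, ← abs_le, not_le, div_lt_iff₀ (by positivity)] at hn
    rw [abs_mul, abs_of_pos (by positivity : (0 : ℝ) < 2 * Real.pi)]
    linarith
  have hFint : Integrable (𝓕 k) := hcont.integrable_of_hasCompactSupport hcs
  have hinv : ∀ t : ℝ, k t = ∫ ξ : ℝ, Complex.exp (2 * Real.pi * ξ * t * Complex.I) * 𝓕 k ξ := by
    intro t
    conv_lhs => rw [← hk.continuous.fourierInv_fourier_eq hk0 hFint, Real.fourierInv_eq']
    refine integral_congr_ae (Eventually.of_forall fun ξ => ?_)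
    simp [mul_comm, mul_left_comm, mul_assoc]
  have hexp : ∀ t : ℝ, Integrable fun ξ : ℝ =>
      Complex.exp (2 * Real.pi * ξ * t * Complex.I) * 𝓕 k ξ := by
    intro t
    refine hFint.norm.mono' (by fun_prop) (Eventually.of_forall fun ξ => ?_)
    rw [norm_mul, show (2 * Real.pi * ξ * t * Complex.I : ℂ)
      = ((2 * Real.pi * ξ * t : ℝ) : ℂ) * Complex.I by push_cast; ring,
      Complex.norm_exp_ofReal_mul_I, one_mul]
  have hFd : 𝓕 (deriv k) = fun ξ : ℝ => (2 * Real.pi * Complex.I * ξ) • 𝓕 k ξ :=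
    Real.fourier_deriv hk0 (hk.differentiable (by simp)) hk1
  have hFdint : Integrable (𝓕 (deriv k)) := by
    rw [hFd]
    refine Continuous.integrable_of_hasCompactSupport (by fun_prop) ?_
    exact hcs.mono fun ξ hξ h0 => hξ (by simp [h0])
  have hd : deriv k 0 = ∫ ξ : ℝ, (2 * Real.pi * Complex.I * ξ) * 𝓕 k ξ := by
    have hcd : Continuous (deriv k) := hk.continuous_deriv (by simp)
    conv_lhs => rw [← hcd.fourierInv_fourier_eq hk1 hFdint, Real.fourierInv_eq', hFd]
    simp
  set a : ℕ → ℝ := fun n => (2 * n + 1) * Real.pi / (2 * σ)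
  set c : ℕ → ℝ := fun n => σ * (8 / Real.pi ^ 2) * ((-1) ^ n / (2 * n + 1 : ℝ) ^ 2)
  have hcn : ∀ n, ‖c n‖ = σ * (8 / Real.pi ^ 2) * (1 / (2 * n + 1 : ℝ) ^ 2) := by
    intro n
    simp only [c, norm_mul, norm_div, norm_pow, norm_neg, norm_one, one_pow]
    rw [Real.norm_of_nonneg hσ.le, Real.norm_of_nonneg (by positivity : 0 ≤ Real.pi),
      Real.norm_of_nonneg (by positivity : (0:ℝ) ≤ 2 * n + 1)]
    norm_num
  have hcsum : HasSum (fun n => ‖c n‖) σ := by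
    have h := hasSum_one_div_odd_sq.mul_left (σ * (8 / Real.pi ^ 2))
    rw [show σ * (8 / Real.pi ^ 2) * (Real.pi ^ 2 / 8) = σ by
      have := Real.pi_ne_zero
      field_simp] at h
    exact h.congr_fun hcn
  -- `2πiξ * 𝓕 k ξ` is expanded in the triangle wave and integrated termwise
  set F : ℕ → ℝ → ℂ := fun n ξ =>
    (c n * Real.sin (2 * Real.pi * ξ * a n) : ℝ) * Complex.I * 𝓕 k ξ
  have hFle : ∀ n ξ, ‖F n ξ‖ ≤ ‖c n‖ * ‖𝓕 k ξ‖ := by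
    intro n ξ
    simp only [F, norm_mul, Complex.norm_I, mul_one, Complex.norm_real]
    gcongr
    exact mul_le_of_le_one_right (norm_nonneg _) (Real.abs_sin_le_one _)
  have hFi : ∀ n, Integrable (F n) := fun n =>
    (hFint.norm.const_mul ‖c n‖).mono' (by fun_prop) (Eventually.of_forall (hFle n))
  have hFs : ∀ ξ, HasSum (fun n => F n ξ) (2 * Real.pi * Complex.I * ξ * 𝓕 k ξ) := by
    intro ξ
    by_cases h : |2 * Real.pi * ξ| ≤ σ
    · have h := ((Complex.hasSum_ofReal.2 (hasSum_triangleWave hσ h)).mul_right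
        Complex.I).mul_right (𝓕 k ξ)
      rw [show ((2 * Real.pi * ξ : ℝ) : ℂ) * Complex.I * 𝓕 k ξ
        = 2 * Real.pi * Complex.I * ξ * 𝓕 k ξ by push_cast; ring] at h
      exact h.congr_fun fun n => rfl
    · simp [F, hsupp ξ (not_le.1 h)]
  have hterm : ∀ n, ∫ ξ, F n ξ = c n * ((k (a n) - k (-a n)) / 2) := by
    intro n
    rw [hinv, hinv, ← integral_sub, ← integral_div, ← integral_const_mul]
    · refine integral_congr_ae (Eventually.of_forall fun ξ => ?_)
      simp only [F]
      push_cast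
      rw [Complex.sin]
      ring_nf
      simp
      ring
    · exact hexp _
    · exact hexp _
  have hsum := hasSum_integral_of_summable_integral_norm hFi (by
    refine Summable.of_nonneg_of_le (fun n => integral_nonneg fun _ => norm_nonneg _)
      (fun n => ?_) (hcsum.summable.mul_right (∫ ξ, ‖𝓕 k ξ‖))
    rw [← integral_const_mul]
    exact integral_mono (hFi n).norm (hFint.norm.const_mul _) (hFle n))
  simp_rw [fun ξ => (hFs ξ).tsum_eq, ← hd, hterm] at hsum
  rw [← hsum.tsum_eq]
  refine tsum_of_norm_bounded (hcsum.mul_right B) fun n => ?_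
  rw [norm_mul, Complex.norm_real, norm_div, Complex.norm_two]
  gcongr
  linarith [norm_sub_le (k (a n)) (k (-a n)), hB (a n), hB (-a n)]

/-- A band-limited function with quadratic decay of all derivatives: the Fourier transform of a
normalised bump function. Multiplication by `g (ε * t)` makes a bounded function integrable while
enlarging its spectrum by only `O(ε)`. -/
theorem exists_bandlimited_cutoff :
    ∃ (g : ℝ → ℂ) (r C : ℝ), 0 < r ∧ 0 ≤ C ∧ ContDiff ℝ ∞ g ∧ g 0 = 1 ∧ (∀ t, ‖g t‖ ≤ 1) ∧
      ∀ (n : ℕ) (t : ℝ), (1 + t ^ 2) * ‖iteratedDeriv n g t‖ ≤ C * r ^ n := by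
  let φ : ContDiffBump (0 : ℝ) := ⟨1 / 2, 1, by norm_num, by norm_num⟩
  set f : ℝ → ℂ := fun v => (φ.normed volume v : ℂ)
  have hf : ContDiff ℝ ∞ f := Complex.ofRealCLM.contDiff.comp φ.contDiff_normed
  have hfc : HasCompactSupport f :=
    φ.hasCompactSupport_normed.comp_left (g := fun x : ℝ => (x : ℂ)) Complex.ofReal_zero
  have hfs : ∀ v, 1 < ‖v‖ → v ∉ tsupport f := by
    intro v hv hv'
    have h1 : tsupport f ⊆ tsupport (φ.normed volume) := by
      refine closure_mono fun x hx h0 => hx ?_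
      simp [f, h0]
    have := h1 hv'
    rw [φ.tsupport_normed_eq, mem_closedBall_zero_iff] at this
    exact absurd hv (not_lt.2 this)
  have hcont : ∀ p : ℕ, Continuous (iteratedFDeriv ℝ p f) := fun p =>
    hf.continuous_iteratedFDeriv (by exact_mod_cast le_top)
  have hcs : ∀ p : ℕ, HasCompactSupport (iteratedFDeriv ℝ p f) := fun p =>
    hfc.iteratedFDeriv p
  have hI : ∀ i p : ℕ, Integrable fun v : ℝ => ‖v‖ ^ i * ‖iteratedFDeriv ℝ p f v‖ := by
    intro i p
    have := hcont p
    refine Continuous.integrable_of_hasCompactSupport (by fun_prop) ?_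
    exact (hcs p).mono fun v hv h0 => hv (by simp [h0])
  have hmoment : ∀ i p : ℕ, ∫ v : ℝ, ‖v‖ ^ i * ‖iteratedFDeriv ℝ p f v‖
      ≤ ∫ v : ℝ, ‖iteratedFDeriv ℝ p f v‖ := by
    intro i p
    refine integral_mono (hI i p) (by simpa using hI 0 p) fun v => ?_
    by_cases hv : ‖v‖ ≤ 1
    · exact mul_le_of_le_one_left (norm_nonneg _) (pow_le_one₀ (norm_nonneg _) hv)
    · have h0 : iteratedFDeriv ℝ p f v = 0 := by
        by_contra h
        exact hfs v (not_le.1 hv) (support_iteratedFDeriv_subset p h)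
      simp [h0]
  set D : ℕ → ℝ := fun p => ∫ v : ℝ, ‖iteratedFDeriv ℝ p f v‖
  have hD : ∀ p, 0 ≤ D p := fun p => integral_nonneg fun _ => norm_nonneg _
  have hbound : ∀ n k : ℕ, ∀ t : ℝ, ‖t‖ ^ n * ‖iteratedDeriv k (𝓕 f) t‖ ≤
      (2 * Real.pi) ^ k * (2 * k + 2) ^ n * ((k + 1) * ∑ p ∈ Finset.range (n + 1), D p) := by
    intro n k t
    rw [← norm_iteratedFDeriv_eq_norm_iteratedDeriv]
    refine (Real.pow_mul_norm_iteratedFDeriv_fourier_le (K := ⊤) (N := ⊤) (by simpa using hf)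
      (fun i p _ _ => hI i p) le_top le_top t).trans ?_
    gcongr
    rw [Finset.sum_product]
    refine (Finset.sum_le_sum fun i _ => Finset.sum_le_sum fun p _ => hmoment i p).trans ?_
    simp [D]
  have hfi : Integrable f := hf.continuous.integrable_of_hasCompactSupport hfc
  have hnorm : ∫ v, ‖f v‖ = 1 := by
    rw [← φ.integral_normed (μ := volume)]
    refine integral_congr_ae (Eventually.of_forall fun v => ?_)
    simp only [f]
    rw [Complex.norm_real, Real.norm_of_nonneg (φ.nonneg_normed v)]
  refine ⟨𝓕 f, 16 * Real.pi, 13 * (D 0 + D 1 + D 2), by positivity, ?_, ?_, ?_, fun t => ?_,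
    fun k t => ?_⟩
  · have := hD 0; have := hD 1; have := hD 2
    positivity
  · have := Real.contDiff_fourier (f := f) (N := ⊤) fun n _ => by simpa using hI n 0
    simpa using this
  · rw [Real.fourier_real_eq]
    have : ∫ v, f v = 1 := by
      simp only [f]
      rw [integral_complex_ofReal, φ.integral_normed, Complex.ofReal_one]
    simpa using this
  · rw [← hnorm]
    exact VectorFourier.norm_fourierIntegral_le_integral_norm _ _ _ _ _
  · have h0 := hbound 0 k t
    have h2 := hbound 2 k t
    simp only [Finset.sum_range_succ, Finset.sum_range_zero, pow_zero, one_mul, zero_add, mul_one,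
      Real.norm_eq_abs, sq_abs] at h0 h2
    -- the polynomial factor in `hbound` is absorbed by enlarging the type from `2 * π` to `16 * π`
    have hk : ((k : ℝ) + 1) ≤ 2 ^ k := by exact_mod_cast Nat.lt_two_pow_self
    have hk3 : ((k : ℝ) + 1) ^ 3 ≤ 8 ^ k := by
      calc ((k : ℝ) + 1) ^ 3 ≤ (2 ^ k) ^ 3 := by gcongr
        _ = 8 ^ k := by rw [← pow_mul, mul_comm, pow_mul]; norm_num
    have hk1 : ((k : ℝ) + 1) ≤ ((k : ℝ) + 1) ^ 3 := le_self_pow₀ (by simp) (by norm_num)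
    have hS : 0 ≤ D 0 + D 1 + D 2 := by linarith [hD 0, hD 1, hD 2]
    calc (1 + t ^ 2) * ‖iteratedDeriv k (𝓕 f) t‖
        ≤ (2 * Real.pi) ^ k * ((k + 1) * (D 0 + D 1 + D 2)) +
          (2 * Real.pi) ^ k * (2 * k + 2) ^ 2 * ((k + 1) * (D 0 + D 1 + D 2)) := by
          rw [add_mul, one_mul]
          refine add_le_add (h0.trans ?_) h2
          gcongr
          linarith [hD 1, hD 2]
      _ = (2 * Real.pi) ^ k * (D 0 + D 1 + D 2) * ((k + 1) + 4 * (k + 1) ^ 3) := by ring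
      _ ≤ (2 * Real.pi) ^ k * (D 0 + D 1 + D 2) * (13 * 8 ^ k) := by
          gcongr
          linarith
      _ = 13 * (D 0 + D 1 + D 2) * (16 * Real.pi) ^ k := by
          rw [show 16 * Real.pi = 8 * (2 * Real.pi) by ring, mul_pow 8]
          ring

/-- Bernstein's inequality, at the origin, for bounded functions of exponential type `σ`. The bound
holds with the supremum `B` of `h`, whatever the constant `C` in the hypothesis on the
derivatives. -/
theorem norm_deriv_zero_le_of_bounded {h : ℝ → ℂ} {σ C B : ℝ} (hσ : 0 < σ)
    (hh : ContDiff ℝ ∞ h) (hC : ∀ (n : ℕ) (t : ℝ), ‖iteratedDeriv n h t‖ ≤ C * σ ^ n)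
    (hB : ∀ t, ‖h t‖ ≤ B) : ‖deriv h 0‖ ≤ σ * B := by
  obtain ⟨g, r, C', hr, hC', hg, hg0, hg1, hgb⟩ := exists_bandlimited_cutoff
  have hC0 : 0 ≤ C := by simpa using (norm_nonneg _).trans (hC 0 0)
  -- Bernstein's inequality for the integrable function `h t * g (ε * t)` of type `σ + ε * r`
  have key : ∀ ε > 0, ‖deriv h 0‖ ≤ (σ + ε * r) * B + ε * ‖h 0 * deriv g 0‖ := by
    intro ε hε
    set k : ℝ → ℂ := fun t => h t * g (ε * t)
    have hge : ContDiff ℝ ∞ fun t => g (ε * t) := by fun_prop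
    have hk : ContDiff ℝ ∞ k := hh.mul hge
    have hgder : ∀ (n : ℕ) (t : ℝ), ‖iteratedDeriv n (fun t => g (ε * t)) t‖
        ≤ C' * (ε * r) ^ n * (1 + (ε * t) ^ 2)⁻¹ := by
      intro n t
      rw [iteratedDeriv_comp_const_smul (hg.of_le (by exact_mod_cast le_top)) ε]
      rw [norm_smul, norm_pow, Real.norm_of_nonneg hε.le, ← div_eq_mul_inv,
        le_div_iff₀ (by positivity), mul_pow]
      calc _ = ε ^ n * ((1 + (ε * t) ^ 2) * ‖iteratedDeriv n g (ε * t)‖) := by ring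
        _ ≤ ε ^ n * (C' * r ^ n) := mul_le_mul_of_nonneg_left (hgb n _) (by positivity)
        _ = _ := by ring
    have hkder : ∀ (n : ℕ) (t : ℝ), ‖iteratedDeriv n k t‖
        ≤ C * C' * (σ + ε * r) ^ n * (1 + (ε * t) ^ 2)⁻¹ := by
      intro n t
      rw [← norm_iteratedFDeriv_eq_norm_iteratedDeriv]
      refine (norm_iteratedFDeriv_mul_le hh hge t (n := n)
        (by exact_mod_cast le_top)).trans ?_
      rw [add_pow, Finset.mul_sum, Finset.sum_mul]
      refine Finset.sum_le_sum fun i _ => ?_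
      rw [norm_iteratedFDeriv_eq_norm_iteratedDeriv, norm_iteratedFDeriv_eq_norm_iteratedDeriv]
      calc _ ≤ (n.choose i : ℝ) * (C * σ ^ i) *
            (C' * (ε * r) ^ (n - i) * (1 + (ε * t) ^ 2)⁻¹) := by
            gcongr
            · exact hC i t
            · exact hgder _ t
        _ = _ := by ring
    have hwi : Integrable fun t : ℝ => (1 + (ε * t) ^ 2)⁻¹ :=
      integrable_inv_one_add_sq.comp_mul_left' hε.ne'
    have hki : ∀ n : ℕ, Integrable (iteratedDeriv n k) := fun n =>
      (hwi.const_mul _).mono' (hk.continuous_iteratedDeriv n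
        (by exact_mod_cast le_top)).aestronglyMeasurable (Eventually.of_forall (hkder n))
    have hbern := norm_deriv_zero_le_of_integral_norm_iteratedDeriv_le (k := k) (σ := σ + ε * r)
      (C := C * C' * ∫ t : ℝ, (1 + (ε * t) ^ 2)⁻¹) (B := B) (by positivity) hk hki
      (fun n => by
        refine (integral_mono (hki n).norm (hwi.const_mul _) (hkder n)).trans_eq ?_
        rw [integral_const_mul]
        ring)
      (fun t => by
        rw [norm_mul]
        exact (mul_le_of_le_one_right (norm_nonneg _) (hg1 _)).trans (hB t))
    have hder : deriv k 0 = deriv h 0 + ε * (h 0 * deriv g 0) := by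
      have h1 : HasDerivAt h (deriv h 0) 0 := (hh.differentiable (by simp) 0).hasDerivAt
      have h2 : HasDerivAt g (deriv g 0) (ε * 0) := by
        rw [mul_zero]
        exact (hg.differentiable (by simp) 0).hasDerivAt
      have h3 : HasDerivAt (fun t => g (ε * t)) (ε • deriv g 0) 0 := by
        simpa [Function.comp_def] using h2.scomp (0 : ℝ) ((hasDerivAt_id (0 : ℝ)).const_mul ε)
      have h4 := (h1.mul h3).deriv
      simp only [mul_zero, hg0, mul_one, Complex.real_smul] at h4
      refine Eq.trans ?_ (h4.trans (by ring))
      rfl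
    have hsplit : deriv h 0 = deriv k 0 - ε * (h 0 * deriv g 0) := by rw [hder]; ring
    calc ‖deriv h 0‖ ≤ ‖deriv k 0‖ + ‖(ε : ℂ) * (h 0 * deriv g 0)‖ := by
          rw [hsplit]; exact norm_sub_le _ _
      _ ≤ _ := by
          rw [norm_mul (ε : ℂ), Complex.norm_real, Real.norm_of_nonneg hε.le]
          gcongr
  have hlim : Tendsto (fun ε : ℝ => (σ + ε * r) * B + ε * ‖h 0 * deriv g 0‖) (𝓝[>] 0)
      (𝓝 ((σ + 0 * r) * B + 0 * ‖h 0 * deriv g 0‖)) :=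
    (Continuous.tendsto (by fun_prop) 0).mono_left nhdsWithin_le_nhds
  simpa using ge_of_tendsto hlim (eventually_mem_nhdsWithin.mono key)

end Fourier

/-! ### Generators of isometry groups -/

section Generator

variable {𝕜 E : Type*} [RCLike 𝕜] [NormedAddCommGroup E] [NormedSpace 𝕜 E]

/-- A one-parameter group of linear isometries of `E`. No continuity in the parameter is asked for,
so that translations on `L_∞` are covered. -/
structure IsIsometryGroup (T : ℝ → E →ₗ[𝕜] E) : Prop where
  zero_apply : ∀ f, T 0 f = f
  add_apply : ∀ s t f, T (s + t) f = T s (T t f)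
  norm_apply : ∀ t f, ‖T t f‖ = ‖f‖

theorem HasGeneratorAt.sub {T : ℝ → E →ₗ[𝕜] E} {f₁ g₁ f₂ g₂ : E}
    (h₁ : HasGeneratorAt 𝕜 T f₁ g₁) (h₂ : HasGeneratorAt 𝕜 T f₂ g₂) :
    HasGeneratorAt 𝕜 T (f₁ - f₂) (g₁ - g₂) := by
  simpa [sub_eq_add_neg] using h₁.add (h₂.smul (-1))

theorem HasGeneratorAt.unique {T : ℝ → E →ₗ[𝕜] E} {f g₁ g₂ : E}
    (h₁ : HasGeneratorAt 𝕜 T f g₁) (h₂ : HasGeneratorAt 𝕜 T f g₂) : g₁ = g₂ :=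
  tendsto_nhds_unique h₁ h₂

theorem exists_generator_apply_eq_iff {T : ℝ → E →ₗ[𝕜] E} {f g : E} :
    (∃ h : f ∈ (generator T).domain, generator T ⟨f, h⟩ = g) ↔ HasGeneratorAt 𝕜 T f g := by
  constructor
  · rintro ⟨h, rfl⟩
    exact generator_spec T ⟨f, h⟩
  · intro h
    exact ⟨⟨g, h⟩, (generator_spec T ⟨f, ⟨g, h⟩⟩).unique h⟩

namespace IsIsometryGroup

variable {T : ℝ → E →ₗ[𝕜] E}

/-- Orbits of elements of the domain are differentiable at all times, tested against functionals. -/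
theorem hasDerivAt_dual (hT : IsIsometryGroup T) {f g : E} (h : HasGeneratorAt 𝕜 T f g)
    (φ : StrongDual 𝕜 E) (t : ℝ) : HasDerivAt (fun s => φ (T s f)) (φ (T t g)) t := by
  have hc : Continuous (T t) :=
    (AddMonoidHomClass.isometry_of_norm (T t) (hT.norm_apply t)).continuous
  rw [hasDerivAt_iff_tendsto_slope_zero]
  refine (((φ.continuous.comp hc).tendsto g).comp h).congr fun s => ?_
  simp only [Function.comp_apply, map_smul, map_sub, hT.add_apply]
  rw [RCLike.real_smul_eq_coe_smul (K := 𝕜)]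

theorem norm_apply_sub_le (hT : IsIsometryGroup T) {f g : E} (h : HasGeneratorAt 𝕜 T f g)
    (t : ℝ) : ‖T t f - f‖ ≤ ‖g‖ * |t| := by
  obtain ⟨φ, hφ, hφe⟩ := exists_dual_vector'' 𝕜 (T t f - f)
  have hmv := Convex.norm_image_sub_le_of_norm_hasDerivWithin_le (f := fun s => φ (T s f))
    (f' := fun s => φ (T s g)) (C := ‖g‖) (x := 0) (y := t) (s := Set.univ)
    (fun s _ => (hT.hasDerivAt_dual h φ s).hasDerivWithinAt)
    (fun s _ => (φ.le_of_opNorm_le hφ _).trans_eq (by rw [one_mul, hT.norm_apply]))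
    convex_univ (Set.mem_univ _) (Set.mem_univ _)
  rw [hT.zero_apply, ← map_sub, hφe] at hmv
  simpa using hmv

/-- The generator of a group of isometries is closed. Strong continuity is not needed: by
`norm_apply_sub_le` the difference quotients of `x n` converge to those of `f` uniformly in `t`. -/
theorem hasGeneratorAt_of_tendsto (hT : IsIsometryGroup T) {x y : ℕ → E} {f g : E}
    (h : ∀ n, HasGeneratorAt 𝕜 T (x n) (y n)) (hx : Tendsto x atTop (𝓝 f))
    (hy : Tendsto y atTop (𝓝 g)) : HasGeneratorAt 𝕜 T f g := by
  have hq : ∀ n t, ‖((t⁻¹ : ℝ) : 𝕜) • (T t f - f) - ((t⁻¹ : ℝ) : 𝕜) • (T t (x n) - x n)‖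
      ≤ ‖g - y n‖ := by
    intro n t
    have hc : Continuous (T t) :=
      (AddMonoidHomClass.isometry_of_norm (T t) (hT.norm_apply t)).continuous
    have hlim : Tendsto (fun m => ((t⁻¹ : ℝ) : 𝕜) • (T t (x m) - x m) -
        ((t⁻¹ : ℝ) : 𝕜) • (T t (x n) - x n)) atTop
        (𝓝 (((t⁻¹ : ℝ) : 𝕜) • (T t f - f) - ((t⁻¹ : ℝ) : 𝕜) • (T t (x n) - x n))) :=
      ((((hc.tendsto f).comp hx).sub hx).const_smul _).sub_const _
    refine le_of_tendsto_of_tendsto' hlim.norm (hy.sub_const (y n)).norm fun m => ?_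
    rw [← smul_sub, sub_sub_sub_comm, ← map_sub, norm_smul]
    have := hT.norm_apply_sub_le ((h m).sub (h n)) t
    rcases eq_or_ne t 0 with rfl | ht
    · simp
    · rw [RCLike.norm_ofReal, abs_inv, inv_mul_le_iff₀ (abs_pos.2 ht)]
      linarith
  have hunif : TendstoUniformlyOnFilter (fun n t => ((t⁻¹ : ℝ) : 𝕜) • (T t (x n) - x n))
      (fun t => ((t⁻¹ : ℝ) : 𝕜) • (T t f - f)) atTop (𝓝[≠] 0) := by
    rw [Metric.tendstoUniformlyOnFilter_iff]
    intro ε hε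
    have hy0 : Tendsto (fun n => ‖g - y n‖) atTop (𝓝 0) := by
      simpa using (hy.const_sub g).norm
    refine ((hy0.eventually (gt_mem_nhds hε)).prod_mk (Eventually.of_forall fun _ => trivial)).mono
      fun p hp => ?_
    rw [dist_eq_norm]
    exact (hq _ _).trans_lt hp.1
  exact hunif.tendsto_of_eventually_tendsto (Eventually.of_forall h) hy

/-- Bernstein's inequality for the generator of a group of isometries: if `‖D ^ k f‖ ≤ C * σ ^ k` for
all `k`, with `u k = D ^ k f`, then `‖D f‖ ≤ σ * ‖f‖`. The orbit of `f` is tested against a functional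
that norms `D f`. -/
theorem norm_le_of_hasGeneratorAt (hT : IsIsometryGroup T) {u : ℕ → E} {σ C : ℝ} (hσ : 0 < σ)
    (hu : ∀ k, HasGeneratorAt 𝕜 T (u k) (u (k + 1))) (hC : ∀ k, ‖u k‖ ≤ C * σ ^ k) :
    ‖u 1‖ ≤ σ * ‖u 0‖ := by
  obtain ⟨φ, hφ, hφe⟩ := exists_dual_vector'' 𝕜 (u 1)
  -- the scalar inequality is complex-valued, so `𝕜` is embedded isometrically into `ℂ`
  obtain ⟨ψ, hψ⟩ : ∃ ψ : 𝕜 →L[ℝ] ℂ, ∀ z, ‖ψ z‖ = ‖z‖ := by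
    refine ⟨Complex.ofRealCLM.comp RCLike.reCLM + Complex.I • Complex.ofRealCLM.comp RCLike.imCLM,
      fun z => ?_⟩
    rw [← sq_eq_sq₀ (norm_nonneg _) (norm_nonneg _), Complex.sq_norm,
      Complex.normSq_apply, ← RCLike.normSq_eq_def', RCLike.normSq_apply]
    simp
  have hder : ∀ k t, HasDerivAt (fun s => ψ (φ (T s (u k)))) (ψ (φ (T t (u (k + 1))))) t :=
    fun k t => ψ.hasFDerivAt.comp_hasDerivAt t (hT.hasDerivAt_dual (hu k) φ t)
  have hiter : ∀ k, iteratedDeriv k (fun s => ψ (φ (T s (u 0)))) = fun s => ψ (φ (T s (u k))) := by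
    intro k
    induction k with
    | zero => simp
    | succ k ih =>
      rw [iteratedDeriv_succ, ih]
      exact funext fun t => (hder k t).deriv
  have hb : ∀ k t, ‖ψ (φ (T t (u k)))‖ ≤ ‖u k‖ := fun k t => by
    rw [hψ]
    exact (φ.le_of_opNorm_le hφ _).trans_eq (by rw [one_mul, hT.norm_apply])
  have hsmooth : ContDiff ℝ ∞ fun s => ψ (φ (T s (u 0))) := by
    refine contDiff_of_differentiable_iteratedDeriv fun k _ => ?_
    rw [hiter]
    exact fun t => (hder k t).differentiableAt
  have := norm_deriv_zero_le_of_bounded hσ hsmooth (C := C)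
    (fun k t => by rw [hiter]; exact (hb k t).trans (hC k)) (hb 0)
  rw [(hder 0 0).deriv, hψ, hT.zero_apply, zero_add, hφe] at this
  simpa using this

end IsIsometryGroup

end Generator

/-! ### The Bernstein set -/

section Bernstein

variable {𝕜 E ι : Type*} [RCLike 𝕜] [NormedAddCommGroup E] [NormedSpace 𝕜 E]

namespace IsIteratedValue

section

variable {D : ι → E →ₗ.[𝕜] E}

theorem unique {w : List ι} {f g₁ g₂ : E} (h₁ : IsIteratedValue D w f g₁)
    (h₂ : IsIteratedValue D w f g₂) : g₁ = g₂ := by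
  induction w generalizing g₁ g₂ with
  | nil => exact Eq.trans h₁ (Eq.symm h₂)
  | cons i w ih =>
    obtain ⟨x₁, hx₁, rfl⟩ := h₁
    obtain ⟨x₂, hx₂, rfl⟩ := h₂
    rw [Subtype.ext (ih hx₁ hx₂)]

theorem add {w : List ι} {f₁ g₁ f₂ g₂ : E} (h₁ : IsIteratedValue D w f₁ g₁)
    (h₂ : IsIteratedValue D w f₂ g₂) : IsIteratedValue D w (f₁ + f₂) (g₁ + g₂) := by
  induction w generalizing g₁ g₂ with
  | nil => exact congrArg₂ (· + ·) h₁ h₂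
  | cons i w ih =>
    obtain ⟨x₁, hx₁, rfl⟩ := h₁
    obtain ⟨x₂, hx₂, rfl⟩ := h₂
    exact ⟨x₁ + x₂, ih hx₁ hx₂, (D i).map_add x₁ x₂⟩

theorem smul {w : List ι} {f g : E} (c : 𝕜) (h : IsIteratedValue D w f g) :
    IsIteratedValue D w (c • f) (c • g) := by
  induction w generalizing g with
  | nil => exact congrArg (c • ·) h
  | cons i w ih =>
    obtain ⟨x, hx, rfl⟩ := h
    exact ⟨c • x, ih hx, (D i).map_smul c x⟩

/-- `D_v D_w f` is computed by applying `D_w` first. -/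
theorem append_iff {v w : List ι} {f g : E} :
    IsIteratedValue D (v ++ w) f g ↔
      ∃ h, IsIteratedValue D w f h ∧ IsIteratedValue D v h g := by
  induction v generalizing g with
  | nil => exact ⟨fun h => ⟨g, h, rfl⟩, fun ⟨h, h₁, h₂⟩ => by rwa [show g = h from h₂]⟩
  | cons i v ih =>
    constructor
    · rintro ⟨x, hx, rfl⟩
      obtain ⟨h, h₁, h₂⟩ := ih.1 hx
      exact ⟨h, h₁, x, h₂, rfl⟩
    · rintro ⟨h, h₁, x, h₂, rfl⟩
      exact ⟨x, ih.2 ⟨h, h₁, h₂⟩, rfl⟩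

end

theorem cons_iff_hasGeneratorAt {T : ι → ℝ → E →ₗ[𝕜] E} {i : ι} {w : List ι} {f g : E} :
    IsIteratedValue (fun j => generator (T j)) (i :: w) f g ↔
      ∃ h, IsIteratedValue (fun j => generator (T j)) w f h ∧ HasGeneratorAt 𝕜 (T i) h g := by
  constructor
  · rintro ⟨x, hx, rfl⟩
    exact ⟨x, hx, generator_spec _ x⟩
  · rintro ⟨h, hx, hg⟩
    obtain ⟨hd, he⟩ := exists_generator_apply_eq_iff.2 hg
    exact ⟨⟨h, hd⟩, hx, he⟩

end IsIteratedValue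

variable {T : ι → ℝ → E →ₗ[𝕜] E} {σ : ℝ}

/-- Bernstein's inequality applied to the words `i, …, i`. The conclusion compares with `‖h‖`, while
the hypothesis allows any constant `C`. -/
theorem norm_le_of_hasGeneratorAt_of_forall_word (hT : ∀ i, IsIsometryGroup (T i)) (hσ : 0 < σ)
    {h g : E} {C : ℝ} (hh : ∀ w, ∃ g, IsIteratedValue (fun j => generator (T j)) w h g ∧
      ‖g‖ ≤ C * σ ^ w.length) {i : ι} (hg : HasGeneratorAt 𝕜 (T i) h g) :
    ‖g‖ ≤ σ * ‖h‖ := by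
  choose u hu hub using fun k : ℕ => hh (List.replicate k i)
  have hstep : ∀ k, HasGeneratorAt 𝕜 (T i) (u k) (u (k + 1)) := by
    intro k
    have := hu (k + 1)
    rw [List.replicate_succ] at this
    obtain ⟨x, hx, hxg⟩ := IsIteratedValue.cons_iff_hasGeneratorAt.1 this
    rwa [hx.unique (hu k)] at hxg
  have h0 : u 0 = h := hu 0
  have h1 : u 1 = g := (hstep 0).unique (by rwa [h0])
  rw [← h0, ← h1]
  exact (hT i).norm_le_of_hasGeneratorAt hσ hstep fun k => by simpa using hub k

/-- The Bernstein set is characterised by bounds with an arbitrary constant `C` in place of `‖f‖`; in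
this form stability under sums and under the generators is evident. The generators need not
commute: the sharp bound is obtained letter by letter, since `D_w f` satisfies the same kind of
bounds as `f`. -/
theorem mem_bernsteinSet_iff (hT : ∀ i, IsIsometryGroup (T i)) (hσ : 0 < σ) {f : E} :
    f ∈ bernsteinSet (fun j => generator (T j)) σ ↔
      ∃ C : ℝ, ∀ w, ∃ g, IsIteratedValue (fun j => generator (T j)) w f g ∧
        ‖g‖ ≤ C * σ ^ w.length := by
  constructor
  · refine fun hf => ⟨‖f‖, fun w => ?_⟩
    obtain ⟨g, hg, hb⟩ := hf w
    exact ⟨g, hg, hb.trans_eq (mul_comm _ _)⟩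
  · rintro ⟨C, hC⟩ w
    induction w with
    | nil => exact ⟨f, rfl, by simp⟩
    | cons i w ih =>
      obtain ⟨h, hh, hb⟩ := ih
      obtain ⟨g, hg, -⟩ := hC (i :: w)
      refine ⟨g, hg, ?_⟩
      obtain ⟨h', hh', hg'⟩ := IsIteratedValue.cons_iff_hasGeneratorAt.1 hg
      obtain rfl := hh.unique hh'
      have := norm_le_of_hasGeneratorAt_of_forall_word hT hσ (C := C * σ ^ w.length)
        (fun v => by
          obtain ⟨x, hx, hxb⟩ := hC (v ++ w)
          obtain ⟨y, hy, hyx⟩ := IsIteratedValue.append_iff.1 hx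
          obtain rfl := hy.unique hh
          refine ⟨x, hyx, hxb.trans_eq ?_⟩
          rw [List.length_append, pow_add]
          ring) hg'
      calc ‖g‖ ≤ σ * ‖h‖ := this
        _ ≤ σ * (σ ^ w.length * ‖f‖) := by gcongr
        _ = σ ^ (i :: w).length * ‖f‖ := by rw [List.length_cons, pow_succ]; ring

theorem generator_mem_bernsteinSet (hT : ∀ i, IsIsometryGroup (T i)) (hσ : 0 < σ) {f g : E}
    (hf : f ∈ bernsteinSet (fun j => generator (T j)) σ) {i : ι}
    (hg : HasGeneratorAt 𝕜 (T i) f g) : g ∈ bernsteinSet (fun j => generator (T j)) σ := by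
  refine (mem_bernsteinSet_iff hT hσ).2 ⟨σ * ‖f‖, fun w => ?_⟩
  -- words ending in `i` are the ones that apply `D i` first
  obtain ⟨x, hx, hb⟩ := hf (w ++ [i])
  obtain ⟨y, hy, hyx⟩ := IsIteratedValue.append_iff.1 hx
  obtain ⟨f', hf', hy'⟩ := IsIteratedValue.cons_iff_hasGeneratorAt.1 hy
  obtain rfl : f' = f := hf'
  obtain rfl := hy'.unique hg
  refine ⟨x, hyx, hb.trans_eq ?_⟩
  rw [List.length_append, List.length_singleton, pow_succ]
  ring

/-- The Bernstein set of generators of isometry groups, as a subspace. -/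
def bernsteinSubmodule (hT : ∀ i, IsIsometryGroup (T i)) (hσ : 0 < σ) : Submodule 𝕜 E where
  carrier := bernsteinSet (fun j => generator (T j)) σ
  zero_mem' := fun w => ⟨0, by
    induction w with
    | nil => rfl
    | cons i w ih => exact ⟨0, ih, (generator (T i)).map_zero⟩, by simp⟩
  add_mem' := by
    intro f₁ f₂ h₁ h₂
    refine (mem_bernsteinSet_iff hT hσ).2 ⟨‖f₁‖ + ‖f₂‖, fun w => ?_⟩
    obtain ⟨g₁, hg₁, hb₁⟩ := h₁ w
    obtain ⟨g₂, hg₂, hb₂⟩ := h₂ w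
    exact ⟨g₁ + g₂, hg₁.add hg₂, (norm_add_le _ _).trans (by linarith)⟩
  smul_mem' := by
    intro c f h w
    obtain ⟨g, hg, hb⟩ := h w
    refine ⟨c • g, hg.smul c, ?_⟩
    rw [norm_smul, norm_smul, mul_left_comm]
    gcongr

theorem isClosed_bernsteinSet [CompleteSpace E] (hT : ∀ i, IsIsometryGroup (T i)) (hσ : 0 < σ) :
    IsClosed (bernsteinSet (fun j => generator (T j)) σ) := by
  refine IsSeqClosed.isClosed fun x f hx hxf => ?_
  have hxB : ∀ n, x n ∈ bernsteinSubmodule hT hσ := hx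
  choose v hv hvb using hx
  have hlim : ∀ w, ∃ g, Tendsto (fun n => v n w) atTop (𝓝 g) := by
    intro w
    refine cauchySeq_tendsto_of_complete (Metric.cauchySeq_iff.2 fun ε hε => ?_)
    have hpow : 0 < σ ^ w.length := pow_pos hσ _
    obtain ⟨N, hN⟩ := Metric.cauchySeq_iff.1 hxf.cauchySeq (ε / σ ^ w.length) (by positivity)
    refine ⟨N, fun m hm n hn => ?_⟩
    -- `x m - x n` lies in the Bernstein set, because the latter is a subspace
    obtain ⟨g, hg, hb⟩ := (bernsteinSubmodule hT hσ).sub_mem (hxB m) (hxB n) w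
    have hgv : g = v m w - v n w := by
      refine hg.unique ?_
      simpa [sub_eq_add_neg] using (hv m w).add ((hv n w).smul (-1))
    have hmn := hN m hm n hn
    rw [dist_eq_norm, lt_div_iff₀ hpow] at hmn
    rw [dist_eq_norm, ← hgv]
    linarith
  choose g hg using hlim
  intro w
  refine ⟨g w, ?_, le_of_tendsto_of_tendsto' (hg w).norm (hxf.norm.const_mul _) fun n => hvb n w⟩
  induction w with
  | nil => exact tendsto_nhds_unique (hg []) (hxf.congr fun n => (hv n []).symm)
  | cons i w ih =>
    refine IsIteratedValue.cons_iff_hasGeneratorAt.2 ⟨g w, ih, ?_⟩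
    refine (hT i).hasGeneratorAt_of_tendsto (fun n => ?_) (hg w) (hg (i :: w))
    obtain ⟨h, hh, hgen⟩ := IsIteratedValue.cons_iff_hasGeneratorAt.1 (hv n (i :: w))
    rwa [hh.unique (hv n w)] at hgen

end Bernstein

/-! ### Translations along one-parameter subgroups -/

section LieGroup

variable {n : ℕ} {G : Type*} [TopologicalSpace G] [ChartedSpace (EuclideanSpace ℝ (Fin n)) G]
  [Group G]

/-- In the absence of a one-parameter subgroup with velocity `X` the curve is constantly `1`, which is
a homomorphism too; hence no existence theorem for `exp` is needed for this and `expCurve_add`. -/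
theorem expCurve_zero (X : GroupLieAlgebra (𝓡 n) G) : expCurve X 0 = 1 := by
  unfold expCurve
  split_ifs with h
  · exact (Classical.choose_spec h).map_zero
  · rfl

theorem expCurve_add (X : GroupLieAlgebra (𝓡 n) G) (s t : ℝ) :
    expCurve X (s + t) = expCurve X s * expCurve X t := by
  unfold expCurve
  split_ifs with h
  · exact (Classical.choose_spec h).map_add s t
  · exact (one_mul 1).symm

variable {𝕜 : Type*} [RCLike 𝕜] {M : Type*} [MeasurableSpace M] [MulAction G M]
  [MeasurableConstSMul G M] {μ : Measure M} [SMulInvariantMeasure G M μ]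
  {p : ℝ≥0∞} [Fact (1 ≤ p)]

/-- Translations along `exp (t X)` form a group of isometries of `L_p`, for every `p`, including `∞`. -/
theorem isIsometryGroup_flowOperator (X : GroupLieAlgebra (𝓡 n) G) :
    IsIsometryGroup (flowOperator 𝕜 μ p X) where
  zero_apply f := by
    refine Lp.ext ((Lp.coeFn_compMeasurePreserving f _).trans (Eventually.of_forall fun x => ?_))
    simp [expCurve_zero]
  add_apply s t f := by
    refine Lp.ext ?_
    have h₁ := Lp.coeFn_compMeasurePreserving f
      (measurePreserving_smul (expCurve X (s + t)) μ)
    have h₂ := Lp.coeFn_compMeasurePreserving (flowOperator 𝕜 μ p X t f)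
      (measurePreserving_smul (expCurve X s) μ)
    have h₃ := (measurePreserving_smul (expCurve X s) μ).quasiMeasurePreserving.ae
      (Lp.coeFn_compMeasurePreserving f (measurePreserving_smul (expCurve X t) μ))
    refine EventuallyEq.trans h₁ (EventuallyEq.trans ?_ h₂.symm)
    filter_upwards [h₃] with x hx
    refine Eq.trans ?_ hx.symm
    simp only [Function.comp_apply]
    rw [add_comm, expCurve_add, mul_smul]
  norm_apply t f := Lp.norm_compMeasurePreserving f _

end LieGroup

theorem theorem2p2 {𝕜 : Type*} [RCLike 𝕜] {n m d : ℕ}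
    -- the compact Lie group
    {G : Type*} [TopologicalSpace G] [CompactSpace G] [T2Space G]
    [ChartedSpace (EuclideanSpace ℝ (Fin n)) G] [Group G] [LieGroup (𝓡 n) ∞ G]
    -- the compact connected smooth manifold
    {M : Type*} [TopologicalSpace M] [CompactSpace M] [T2Space M] [ConnectedSpace M]
    [ChartedSpace (EuclideanSpace ℝ (Fin m)) M] [IsManifold (𝓡 m) ∞ M]
    -- the smooth, effective and transitive action
    [MulAction G M] [ContinuousSMul G M] [ContMDiffSMul (𝓡 n) (𝓡 m) ∞ G M]
    [FaithfulSMul G M] [MulAction.IsPretransitive G M]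
    -- the invariant measure
    [MeasurableSpace M] [BorelSpace M] (μ : Measure M) [IsFiniteMeasure μ] [NeZero μ]
    [SMulInvariantMeasure G M μ]
    (p : ℝ≥0∞) [Fact (1 ≤ p)]
    -- the vector fields, given by elements of the Lie algebra
    (X : Fin d → GroupLieAlgebra (𝓡 n) G) (σ : ℝ) (hσ : 0 < σ) :
    (∀ f ∈ bernsteinSet (fun j => fieldOperator 𝕜 μ p (X j)) σ, ∀ ν : Fin d,
      ∃ hf : f ∈ (fieldOperator 𝕜 μ p (X ν)).domain,
        fieldOperator 𝕜 μ p (X ν) ⟨f, hf⟩ ∈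
          bernsteinSet (fun j => fieldOperator 𝕜 μ p (X j)) σ) ∧
    (∃ S : Submodule 𝕜 (Lp 𝕜 p μ),
      (S : Set (Lp 𝕜 p μ)) = bernsteinSet (fun j => fieldOperator 𝕜 μ p (X j)) σ) ∧
    IsClosed (bernsteinSet (fun j => fieldOperator 𝕜 μ p (X j)) σ) := by
  have hT : ∀ j, IsIsometryGroup (flowOperator 𝕜 μ p (X j)) := fun j =>
    isIsometryGroup_flowOperator (X j)
  refine ⟨fun f hf ν => ?_, ⟨bernsteinSubmodule hT hσ, rfl⟩, isClosed_bernsteinSet hT hσ⟩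
  obtain ⟨g, hg, -⟩ := hf [ν]
  obtain ⟨⟨f', hf'⟩, rfl : f' = f, -⟩ := hg
  exact ⟨hf', generator_mem_bernsteinSet hT hσ hf (generator_spec _ ⟨f', hf'⟩)⟩
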